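/- Let $\mathbb D$ be the open unit disc in $\mathbb C$ and $\mathbb B_2$ the open Euclidean unit ball of $\mathbb C^2$. Let $H^2_2$ be the Drury--Arveson space, i.e. the space of functions $h(z)=\sum_{\alpha\in\mathbb N_0^2}c_\alpha z^\alpha$ on $\mathbb B_2$ with $\sum_\alpha |c_\alpha|^2\,\frac{\alpha!}{|\alpha|!}<\infty$, and let $\mathcal M_2=\mathrm{Mult}(H^2_2)=\{\Phi:\mathbb B_2\to\mathbb C:\ \Phi h\in H^2_2 \text{ for all } h\in H^2_2\}$. For $V\subset\mathbb B_2$ put $\mathcal M_V=\{\Phi|_V:\Phi\in\mathcal M_2\}$, and for an injective map $f:\mathbb D\to\mathbb B_2$ with image $V=f(\mathbb D)$ put $\mathcal M_f=\{\varphi:\mathbb D\to\mathbb C:\ \varphi\circ f^{-1}\in\mathcal M_V\}$. For $0<r<1$ let $$b_r(z)=\frac{z-r}{1-rz},\qquad f_r(z)=\frac1{\sqrt2}\left(z^2,\,b_r(z)^2\right),\qquad z\in\mathbb D,$$ which is an injective map from $\mathbb D$ into $\mathbb B_2$. **Theorem.** If $r,s\in(0,1)$ and $r\neq s$, then $\mathcal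 M_{f_r}\neq\mathcal M_{f_s}$ as algebras of functions on $\mathbb D$. -/

import Mathlib

open Complex

/-- The open Euclidean unit ball of `ℂ^d`, as a type. -/
abbrev UnitBall (d : ℕ) : Type := Metric.ball (0 : EuclideanSpace ℂ (Fin d)) 1

/-- The squared norm `α! / |α|!` of the monomial `z^α` in the Drury-Arveson space. -/
noncomputable def druryArvesonWeight {d : ℕ} (α : Fin d → ℕ) : ℝ :=
  (∏ i, (Nat.factorial (α i) : ℝ)) / (Nat.factorial (∑ i, α i) : ℝ)

theorem druryArvesonWeight_nonneg {d : ℕ} (α : Fin d → ℕ) : 0 ≤ druryArvesonWeight α := by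
  unfold druryArvesonWeight
  positivity

/-- The Drury-Arveson space `H²_d`, as a space of functions on the ball: the sums of power series
`∑ c_α z^α` with `∑ |c_α|² α! / |α|! < ∞`. -/
noncomputable def druryArveson (d : ℕ) : Submodule ℂ (UnitBall d → ℂ) where
  carrier := {h | ∃ c : (Fin d → ℕ) → ℂ,
    Summable (fun α => ‖c α‖ ^ 2 * druryArvesonWeight α) ∧
    ∀ z : UnitBall d, HasSum (fun α => c α * ∏ i, (z : EuclideanSpace ℂ (Fin d)) i ^ α i) (h z)}
  zero_mem' := ⟨0, by simp, fun z => by simp⟩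
  add_mem' := by
    rintro h k ⟨a, ha, hh⟩ ⟨b, hb, hk⟩
    refine ⟨a + b, ?_, fun z => ?_⟩
    · refine Summable.of_nonneg_of_le
        (fun α => mul_nonneg (sq_nonneg _) (druryArvesonWeight_nonneg α)) (fun α => ?_)
        ((ha.add hb).mul_left 2)
      have h1 : ‖a α + b α‖ ^ 2 ≤ 2 * (‖a α‖ ^ 2 + ‖b α‖ ^ 2) := by
        have h2 := norm_add_le (a α) (b α)
        have h3 := norm_nonneg (a α + b α)
        nlinarith [sq_nonneg (‖a α‖ - ‖b α‖)]
      have h4 := mul_le_mul_of_nonneg_right h1 (druryArvesonWeight_nonneg α)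
      simp only [Pi.add_apply]
      linarith
    · simpa [add_mul] using (hh z).add (hk z)
  smul_mem' := by
    rintro t h ⟨a, ha, hh⟩
    refine ⟨t • a, ?_, fun z => ?_⟩
    · simpa [mul_pow, mul_assoc] using ha.mul_left (‖t‖ ^ 2)
    · simpa [mul_assoc] using (hh z).mul_left t

/-- The multiplier algebra of a space `H` of complex functions on `X`: all functions `m` on `X`
with `m H ⊆ H`. -/
def multiplierAlgebra {X : Type*} (H : Submodule ℂ (X → ℂ)) : Subalgebra ℂ (X → ℂ) where
  carrier := {m | ∀ h ∈ H, m * h ∈ H}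
  mul_mem' := fun {m n} hm hn h hh => by
    rw [mul_assoc]
    exact hm _ (hn _ hh)
  add_mem' := fun {m n} hm hn h hh => by
    rw [add_mul]
    exact H.add_mem (hm _ hh) (hn _ hh)
  algebraMap_mem' := fun c h hh => by
    rw [← Algebra.smul_def]
    exact H.smul_mem c hh

/-- Composition with a map `f : X → Y`, as an algebra homomorphism of algebras of functions. -/
def compAlgHom {X Y : Type*} (f : X → Y) : (Y → ℂ) →ₐ[ℂ] (X → ℂ) where
  toFun m := m ∘ f
  map_one' := rfl
  map_mul' _ _ := rfl
  map_zero' := rfl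
  map_add' _ _ := rfl
  commutes' _ := rfl

/-- `M_V = {m|_V : m ∈ M_d}`, where `M_d` is the multiplier algebra of the Drury-Arveson space. -/
noncomputable def multiplierAlgebraOn {d : ℕ} (V : Set (UnitBall d)) : Subalgebra ℂ (V → ℂ) :=
  (multiplierAlgebra (druryArveson d)).map (compAlgHom (Subtype.val : V → UnitBall d))

/-- `M_f`, the pull-back of `M_V` to the disc along `f`, where `V = f(𝔻)`. -/
noncomputable def discMultiplierAlgebra {d : ℕ} (f : UnitDisc → UnitBall d) :
    Subalgebra ℂ (UnitDisc → ℂ) :=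
  (multiplierAlgebraOn (Set.range f)).map (compAlgHom (Set.rangeFactorization f))

/-- For injective `f`, `M_f` consists of the `m : 𝔻 → ℂ` with `m ∘ f⁻¹ ∈ M_V`, `V = f(𝔻)`. -/
theorem mem_discMultiplierAlgebra_iff {d : ℕ} (f : UnitDisc → UnitBall d)
    (hf : Function.Injective f) (m : UnitDisc → ℂ) :
    m ∈ discMultiplierAlgebra f ↔
      m ∘ (Equiv.ofInjective f hf).symm ∈ multiplierAlgebraOn (Set.range f) := by
  constructor
  · rintro ⟨n, hn, rfl⟩
    have h : (n ∘ Set.rangeFactorization f) ∘ (Equiv.ofInjective f hf).symm = n := by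
      funext v
      exact congrArg n ((Equiv.ofInjective f hf).apply_symm_apply v)
    exact h.symm ▸ hn
  · intro h
    refine ⟨_, h, ?_⟩
    funext z
    exact congrArg m ((Equiv.ofInjective f hf).symm_apply_apply z)

/-- The Möbius map `b_r(z) = (z - r) / (1 - r z)`. -/
noncomputable def mobius (r : ℝ) (z : ℂ) : ℂ := (z - r) / (1 - r * z)

theorem mobius_denom_ne_zero {r : ℝ} (hr : r ∈ Set.Ioo (0 : ℝ) 1) {z : ℂ} (hz : ‖z‖ < 1) :
    1 - (r : ℂ) * z ≠ 0 := by
  intro h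
  have h1 : ‖(r : ℂ) * z‖ = 1 := by rw [← sub_eq_zero.1 h, norm_one]
  rw [norm_mul, norm_real, Real.norm_of_nonneg hr.1.le] at h1
  nlinarith [hr.1, hr.2, norm_nonneg z]

theorem norm_mobius_lt_one {r : ℝ} (hr : r ∈ Set.Ioo (0 : ℝ) 1) (z : UnitDisc) :
    ‖mobius r z‖ < 1 := by
  have hz : normSq (z : ℂ) < 1 := by
    rw [normSq_eq_norm_sq]
    have := z.norm_lt_one
    nlinarith [norm_nonneg (z : ℂ)]
  obtain ⟨h0, h1⟩ := id hr
  have key : normSq ((z : ℂ) - r) < normSq (1 - r * (z : ℂ)) := by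
    simp only [normSq_apply, sub_re, sub_im, ofReal_re, ofReal_im, one_re, one_im, mul_re,
      mul_im] at hz ⊢
    nlinarith [mul_pos (sub_pos.2 hz) (show 0 < 1 - r ^ 2 by nlinarith)]
  have hpos : 0 < ‖1 - r * (z : ℂ)‖ := norm_pos_iff.2 (mobius_denom_ne_zero hr z.norm_lt_one)
  rw [mobius, norm_div, div_lt_one hpos]
  rw [normSq_eq_norm_sq, normSq_eq_norm_sq] at key
  exact lt_of_pow_lt_pow_left₀ 2 hpos.le key

/-- The map `f_r(z) = (z², b_r(z)²) / √2` from the disc to the ball of `ℂ²`, for `0 < r < 1`. -/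
noncomputable def discEmbedding (r : ℝ) (hr : r ∈ Set.Ioo (0 : ℝ) 1) (z : UnitDisc) :
    UnitBall 2 :=
  ⟨((Real.sqrt 2 : ℝ) : ℂ)⁻¹ • !₂[(z : ℂ) ^ 2, mobius r z ^ 2], by
    have hz := z.norm_lt_one
    have hb := norm_mobius_lt_one hr z
    have hz4 : ‖(z : ℂ)‖ ^ 4 < 1 := pow_lt_one₀ (norm_nonneg _) hz (by norm_num)
    have hb4 : ‖mobius r z‖ ^ 4 < 1 := pow_lt_one₀ (norm_nonneg _) hb (by norm_num)
    rw [mem_ball_zero_iff, ← sq_lt_one_iff₀ (norm_nonneg _), norm_smul, mul_pow,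
      EuclideanSpace.norm_sq_eq]
    simp [Fin.sum_univ_two, ← pow_mul]
    linarith⟩

/-- The maps `f_r` are injective on the open disc, so that `f_r⁻¹` is defined on `f_r(𝔻)`. -/
theorem discEmbedding_injective (r : ℝ) (hr : r ∈ Set.Ioo (0 : ℝ) 1) :
    Function.Injective (discEmbedding r hr) := by
  intro z w h
  have hv := congrArg (fun p : UnitBall 2 => (p : EuclideanSpace ℂ (Fin 2))) h
  have h2 : (((Real.sqrt 2 : ℝ) : ℂ)⁻¹) ≠ 0 := by simp
  have hv' := smul_right_injective (EuclideanSpace ℂ (Fin 2)) h2 hv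
  have e0 : (z : ℂ) ^ 2 = (w : ℂ) ^ 2 := by
    simpa using congrArg (fun p : EuclideanSpace ℂ (Fin 2) => p 0) hv'
  have e1 : mobius r z ^ 2 = mobius r w ^ 2 := by
    simpa using congrArg (fun p : EuclideanSpace ℂ (Fin 2) => p 1) hv'
  have hz := mobius_denom_ne_zero hr z.norm_lt_one
  have hw := mobius_denom_ne_zero hr w.norm_lt_one
  have hr0 : (r : ℂ) ≠ 0 := by exact_mod_cast hr.1.ne'
  have hr1 : (1 : ℂ) - (r : ℂ) ^ 2 ≠ 0 := by
    have : (1 : ℝ) - r ^ 2 ≠ 0 := by nlinarith [hr.1, hr.2]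
    exact_mod_cast this
  apply UnitDisc.coe_injective
  rcases sq_eq_sq_iff_eq_or_eq_neg.1 e0 with hzw | hzw
  · exact hzw
  have hwz : (w : ℂ) = -(z : ℂ) := by rw [hzw, neg_neg]
  rw [hwz] at e1 hw ⊢
  rcases sq_eq_sq_iff_eq_or_eq_neg.1 e1 with hb | hb
  · rw [mobius, mobius, div_eq_div_iff hz hw] at hb
    have h0 : (z : ℂ) * (1 - (r : ℂ) ^ 2) = 0 := by linear_combination hb / 2
    have := (mul_eq_zero.1 h0).resolve_right hr1
    simp [this]
  · rw [mobius, mobius, ← neg_div, div_eq_div_iff hz hw] at hb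
    have h0 : (r : ℂ) * ((z : ℂ) ^ 2 - 1) = 0 := by linear_combination hb / 2
    have h1 := sub_eq_zero.1 ((mul_eq_zero.1 h0).resolve_left hr0)
    have h3 := congrArg norm h1
    rw [norm_pow, norm_one] at h3
    nlinarith [norm_nonneg (z : ℂ), z.norm_lt_one]

/-! Every `f_r` glues the boundary points `1` and `-1` at `(1, 1) / √2`, and the algebra remembers
the relative speed at which they are approached. Since `b_r(-b_r(z)) = -z`, the images under `f_r`
of `z = 1 - ε` and `w = -b_r(z)` differ only by a swap of coordinates. Their kernel vectors have
equal norm, and the normalized distance tends to `0` with `ε` (`norm_kernelVec_sub_of_swap`).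
Multipliers are Lipschitz for this distance (`exists_norm_sub_le_of_mem_multiplierAlgebra`).

Suppose `M_{f_s} ⊆ M_{f_r}`, and let `ζ` be `diagCoord`, which peaks at `(1, 1) / √2`. The functions
`ε / (1 - (1 - ε) ζ)` are power series in `ζ` whose coefficients have `ℓ¹` norm one. Such series are
multipliers because multiplication by `ζ` is a contraction. By uniform boundedness their differences
along `f_s` are controlled by the distance along `f_r`, with a constant independent of `ε`
(`exists_norm_resolvent_sub_le`).

Along `f_s`, `1 - ζ` is to first order `2ε / (1 - s)` at `z` and `2ε(1 + r) / ((1 - r)(1 + s))` at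
`w`. If `1 - ζ ~ εG`, the test function tends to `1 / (1 + G)`. The two limits must agree, which
forces `r = s`. -/

open scoped ComplexConjugate Topology

/-! ### The Drury-Arveson space as a sequence space, and its kernel -/

/-- The model `ℓ²(ℕ × ℕ)` of the Drury-Arveson space of the ball of `ℂ²`, whose standard basis
corresponds to the normalized monomials. -/
abbrev CoeffSpace : Type := lp (fun _ : ℕ × ℕ => ℂ) 2

/-- The series of `1 / (1 - (x + y))` in powers of `x` and `y`, summed along the antidiagonals. -/
theorem hasSum_choose_mul_pow_mul_pow {x y : ℂ} (h : ‖x‖ + ‖y‖ < 1) :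
    HasSum (fun a : ℕ × ℕ => ((a.1 + a.2).choose a.1 : ℂ) * (x ^ a.1 * y ^ a.2))
      (1 - (x + y))⁻¹ := by
  have key : ∀ {R : Type} [NormedField R] (u v : R) (n : ℕ),
      HasSum (fun c : Finset.HasAntidiagonal.antidiagonal n =>
        (((c : ℕ × ℕ).1 + (c : ℕ × ℕ).2).choose (c : ℕ × ℕ).1 : R) *
          (u ^ (c : ℕ × ℕ).1 * v ^ (c : ℕ × ℕ).2)) ((u + v) ^ n) := by
    intro R _ u v n
    rw [(Commute.all u v).add_pow', ← Finset.sum_coe_sort]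
    convert hasSum_fintype _ using 3 with c
    rw [Finset.HasAntidiagonal.mem_antidiagonal.1 c.2, nsmul_eq_mul]
  rw [← Finset.HasAntidiagonal.sigmaAntidiagonalEquivProd.hasSum_iff]
  refine HasSum.sigma_of_hasSum (hasSum_geometric_of_norm_lt_one
    ((norm_add_le x y).trans_lt h)) (key x y) ?_
  refine Summable.of_norm ?_
  rw [summable_sigma_of_nonneg (fun _ => norm_nonneg _)]
  -- The binomial identity over `ℝ`, applied to the norms, gives absolute convergence.
  have h2 : ∀ n, HasSum (fun c : Finset.HasAntidiagonal.antidiagonal n =>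
      ‖((((c : ℕ × ℕ).1 + (c : ℕ × ℕ).2).choose (c : ℕ × ℕ).1 : ℂ)) *
          (x ^ (c : ℕ × ℕ).1 * y ^ (c : ℕ × ℕ).2)‖) ((‖x‖ + ‖y‖) ^ n) := by
    intro n
    simpa using key ‖x‖ ‖y‖ n
  refine ⟨fun n => (h2 n).summable, ?_⟩
  refine (summable_geometric_of_lt_one (by positivity) h).congr fun n => ?_
  exact (h2 n).tsum_eq.symm

/-- The coordinates of a point of the ball. -/
def UnitBall.coord {d : ℕ} (z : UnitBall d) (i : Fin d) : ℂ := z.1 i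

theorem UnitBall.norm_sq_add_norm_sq_lt_one (z : UnitBall 2) :
    ‖z.coord 0‖ ^ 2 + ‖z.coord 1‖ ^ 2 < 1 := by
  have h := mem_ball_zero_iff.1 z.2
  have h2 := EuclideanSpace.norm_sq_eq (z : EuclideanSpace ℂ (Fin 2))
  rw [Fin.sum_univ_two] at h2
  change ‖z.1 0‖ ^ 2 + ‖z.1 1‖ ^ 2 < 1
  rw [← h2]
  exact pow_lt_one₀ (norm_nonneg _) h two_ne_zero

/-- The coefficients of the reproducing kernel at `z`. -/
noncomputable def kernelVec (z : UnitBall 2) : CoeffSpace :=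
  ⟨fun a => (Real.sqrt ((a.1 + a.2).choose a.1) : ℂ) *
    (conj (z.coord 0) ^ a.1 *
      conj (z.coord 1) ^ a.2), by
    refine memℓp_gen ?_
    have h := (hasSum_choose_mul_pow_mul_pow
      (x := ((‖z.coord 0‖ ^ 2 : ℝ) : ℂ))
      (y := ((‖z.coord 1‖ ^ 2 : ℝ) : ℂ))
      (by simpa using z.norm_sq_add_norm_sq_lt_one)).summable.norm
    refine h.congr fun a => ?_
    simp [mul_pow, ← pow_mul, abs_of_nonneg (Real.sqrt_nonneg _), mul_comm]⟩

theorem kernelVec_apply (z : UnitBall 2) (a : ℕ × ℕ) :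
    kernelVec z a = (Real.sqrt ((a.1 + a.2).choose a.1) : ℂ) *
    (conj (z.coord 0) ^ a.1 *
      conj (z.coord 1) ^ a.2) := rfl

/-- The Drury-Arveson kernel is `1 / (1 - ⟨w, z⟩)`. -/
theorem inner_kernelVec (z w : UnitBall 2) :
    inner ℂ (kernelVec z) (kernelVec w) =
      (1 - (z.coord 0 * conj (w.coord 0) +
        z.coord 1 * conj (w.coord 1)))⁻¹ := by
  have hz := z.norm_sq_add_norm_sq_lt_one
  have hw := w.norm_sq_add_norm_sq_lt_one
  have hs := hasSum_choose_mul_pow_mul_pow (x := z.coord 0 * conj (w.coord 0))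
    (y := z.coord 1 * conj (w.coord 1)) (by
      simp only [norm_mul, RCLike.norm_conj]
      nlinarith [sq_nonneg (‖z.coord 0‖ - ‖w.coord 0‖), sq_nonneg (‖z.coord 1‖ - ‖w.coord 1‖)])
  refine (lp.hasSum_inner (kernelVec z) (kernelVec w)).unique
    ((congrArg (HasSum · _) (funext fun a => ?_)).mpr hs)
  have h : (Real.sqrt ((a.1 + a.2).choose a.1) : ℂ) * (Real.sqrt ((a.1 + a.2).choose a.1) : ℂ) =
      ((a.1 + a.2).choose a.1 : ℂ) := by
    rw [← ofReal_mul, Real.mul_self_sqrt (Nat.cast_nonneg _)]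
    simp
  rw [RCLike.inner_apply, kernelVec_apply, kernelVec_apply, ← h]
  simp only [map_mul, map_pow, conj_conj, conj_ofReal]
  ring

theorem druryArvesonWeight_two (α : Fin 2 → ℕ) :
    druryArvesonWeight α = ((α 0 + α 1).choose (α 0) : ℝ)⁻¹ := by
  rw [druryArvesonWeight, Fin.prod_univ_two, Fin.sum_univ_two,
    Nat.cast_add_choose, inv_div]

/-- Functions in the Drury-Arveson space of the ball of `ℂ²` are the pairings of the kernel
vectors with square summable sequences. -/
theorem mem_druryArveson_two_iff (h : UnitBall 2 → ℂ) :
    h ∈ druryArveson 2 ↔ ∃ d : CoeffSpace, ∀ z, h z = inner ℂ (kernelVec z) d := by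
  have hpos : ∀ a : ℕ × ℕ, 0 < (((a.1 + a.2).choose a.1 : ℕ) : ℝ) := fun a => by
    exact_mod_cast Nat.choose_pos (Nat.le_add_right _ _)
  have hne : ∀ a : ℕ × ℕ, (Real.sqrt ((a.1 + a.2).choose a.1) : ℂ) ≠ 0 := fun a => by
    exact_mod_cast (Real.sqrt_pos.2 (hpos a)).ne'
  constructor
  · rintro ⟨c, hc, hh⟩
    -- The normalized monomials are `√(binomial) z^a`, hence the division by the root.
    let d : CoeffSpace := ⟨fun a => c ![a.1, a.2] / (Real.sqrt ((a.1 + a.2).choose a.1) : ℂ), by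
      refine memℓp_gen ?_
      rw [← (finTwoArrowEquiv ℕ).symm.summable_iff] at hc
      refine hc.congr fun a => ?_
      simp [druryArvesonWeight_two, abs_of_nonneg (Real.sqrt_nonneg _), mul_pow, inv_pow,
        div_eq_mul_inv]⟩
    refine ⟨d, fun z => (hh z).unique ?_⟩
    rw [← (finTwoArrowEquiv ℕ).symm.hasSum_iff]
    refine (congrArg (HasSum · _) (funext fun a => ?_)).mpr (lp.hasSum_inner (kernelVec z) d)
    rw [RCLike.inner_apply, kernelVec_apply]
    simp only [map_mul, map_pow, conj_conj, conj_ofReal, d, UnitBall.coord, Function.comp_apply,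
      Fin.prod_univ_two, finTwoArrowEquiv_symm_apply, Matrix.cons_val_zero, Matrix.cons_val_one]
    field_simp [hne a]
  · rintro ⟨d, hd⟩
    refine ⟨fun α => (Real.sqrt ((α 0 + α 1).choose (α 0)) : ℂ) * d (α 0, α 1), ?_, fun z => ?_⟩
    · rw [← (finTwoArrowEquiv ℕ).symm.summable_iff]
      refine ((memℓp_gen_iff (by norm_num)).1 (lp.memℓp d)).congr fun a => ?_
      have := hpos a
      simp [druryArvesonWeight_two, abs_of_nonneg (Real.sqrt_nonneg _), mul_pow]
      field_simp
    · rw [← (finTwoArrowEquiv ℕ).symm.hasSum_iff, hd z]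
      refine (congrArg (HasSum · _) (funext fun a => ?_)).mpr (lp.hasSum_inner (kernelVec z) d)
      rw [RCLike.inner_apply, kernelVec_apply]
      simp only [map_mul, map_pow, conj_conj, conj_ofReal, UnitBall.coord, Function.comp_apply,
        Fin.prod_univ_two, finTwoArrowEquiv_symm_apply, Matrix.cons_val_zero, Matrix.cons_val_one]
      ring

/-! ### Multiplication by the peak function -/

/-- The function of norm one on the ball of `ℂ²` that peaks at `(1, 1) / √2`. -/
noncomputable def diagCoord (z : UnitBall 2) : ℂ :=
  (Real.sqrt 2 : ℂ)⁻¹ * (z.coord 0 + z.coord 1)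

theorem norm_sq_diagCoord_le (z : UnitBall 2) :
    ‖diagCoord z‖ ^ 2 ≤ ‖z.coord 0‖ ^ 2 + ‖z.coord 1‖ ^ 2 := by
  have h := norm_add_le (z.coord 0) (z.coord 1)
  have h0 := norm_nonneg (z.coord 0 + z.coord 1)
  simp only [diagCoord, norm_mul, norm_inv, norm_real, mul_pow, inv_pow, Real.norm_eq_abs, sq_abs,
    Real.sq_sqrt zero_le_two]
  nlinarith [sq_nonneg (‖z.coord 0‖ - ‖z.coord 1‖)]

theorem norm_diagCoord_lt_one (z : UnitBall 2) : ‖diagCoord z‖ < 1 :=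
  (sq_lt_one_iff₀ (norm_nonneg _)).1
    ((norm_sq_diagCoord_le z).trans_lt z.norm_sq_add_norm_sq_lt_one)

/-- The adjoint of multiplication by `diagCoord`, on sequences. -/
noncomputable def coshiftFun (d : ℕ × ℕ → ℂ) (a : ℕ × ℕ) : ℂ :=
  (Real.sqrt 2 : ℂ)⁻¹ *
    ((Real.sqrt ((a.1 + 1) / (a.1 + a.2 + 1)) : ℂ) * d (a.1 + 1, a.2) +
      (Real.sqrt ((a.2 + 1) / (a.1 + a.2 + 1)) : ℂ) * d (a.1, a.2 + 1))

/-- The factor `1 / √2` absorbs the `2` in `‖u + v‖² ≤ 2(‖u‖² + ‖v‖²)`. -/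
theorem norm_coshiftFun_sq_le (d : ℕ × ℕ → ℂ) (a : ℕ × ℕ) :
    ‖coshiftFun d a‖ ^ 2 ≤ ((a.1 + 1) / (a.1 + a.2 + 1)) * ‖d (a.1 + 1, a.2)‖ ^ 2 +
      ((a.2 + 1) / (a.1 + a.2 + 1)) * ‖d (a.1, a.2 + 1)‖ ^ 2 := by
  have hs : (0 : ℝ) ≤ (a.1 + 1) / (a.1 + a.2 + 1) := by positivity
  have ht : (0 : ℝ) ≤ (a.2 + 1) / (a.1 + a.2 + 1) := by positivity
  rw [coshiftFun]
  set u := (Real.sqrt ((a.1 + 1) / (a.1 + a.2 + 1)) : ℂ) * d (a.1 + 1, a.2) with hu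
  set v := (Real.sqrt ((a.2 + 1) / (a.1 + a.2 + 1)) : ℂ) * d (a.1, a.2 + 1) with hv
  have hu2 : ‖u‖ ^ 2 = ((a.1 + 1) / (a.1 + a.2 + 1)) * ‖d (a.1 + 1, a.2)‖ ^ 2 := by
    rw [hu, norm_mul, mul_pow, norm_real, Real.norm_eq_abs, sq_abs, Real.sq_sqrt hs]
  have hv2 : ‖v‖ ^ 2 = ((a.2 + 1) / (a.1 + a.2 + 1)) * ‖d (a.1, a.2 + 1)‖ ^ 2 := by
    rw [hv, norm_mul, mul_pow, norm_real, Real.norm_eq_abs, sq_abs, Real.sq_sqrt ht]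
  rw [← hu2, ← hv2]
  have h := norm_add_le u v
  have h0 := norm_nonneg (u + v)
  simp only [norm_mul, norm_inv, norm_real, mul_pow, inv_pow, Real.norm_eq_abs, sq_abs,
    Real.sq_sqrt zero_le_two]
  nlinarith [sq_nonneg (‖u‖ - ‖v‖)]

/-- Each `‖d b‖²` is collected from at most two indices, `b - (1, 0)` and `b - (0, 1)`, and the two
weights add up to at most one. -/
theorem summable_coshiftFun_and_tsum_le {d : ℕ × ℕ → ℂ} (hd : Summable fun a => ‖d a‖ ^ 2) :
    Summable (fun a => ‖coshiftFun d a‖ ^ 2) ∧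
      ∑' a, ‖coshiftFun d a‖ ^ 2 ≤ ∑' a, ‖d a‖ ^ 2 := by
  let f : ℕ × ℕ → ℝ := fun b => (b.1 / (b.1 + b.2)) * ‖d b‖ ^ 2
  let g : ℕ × ℕ → ℝ := fun b => (b.2 / (b.1 + b.2)) * ‖d b‖ ^ 2
  have hf0 : ∀ b, 0 ≤ f b := fun b => by positivity
  have hg0 : ∀ b, 0 ≤ g b := fun b => by positivity
  have hfg : ∀ b, f b + g b ≤ ‖d b‖ ^ 2 := fun b => by
    simp only [f, g]
    rw [← add_mul, ← add_div]
    -- The weights add up to one except at `b = (0, 0)`, where both are `0 / 0 = 0`.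
    exact mul_le_of_le_one_left (sq_nonneg _) (div_self_le_one _)
  have hf : Summable f := Summable.of_nonneg_of_le hf0 (fun b => by linarith [hfg b, hg0 b]) hd
  have hg : Summable g := Summable.of_nonneg_of_le hg0 (fun b => by linarith [hfg b, hf0 b]) hd
  let i : ℕ × ℕ → ℕ × ℕ := fun a => (a.1 + 1, a.2)
  let j : ℕ × ℕ → ℕ × ℕ := fun a => (a.1, a.2 + 1)
  have hi : Function.Injective i := fun a b h => by
    simp only [i, Prod.mk.injEq, add_left_inj] at h
    exact Prod.ext h.1 h.2
  have hj : Function.Injective j := fun a b h => by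
    simp only [j, Prod.mk.injEq, add_left_inj] at h
    exact Prod.ext h.1 h.2
  have hle : ∀ a, ‖coshiftFun d a‖ ^ 2 ≤ (f ∘ i) a + (g ∘ j) a := fun a => by
    refine (norm_coshiftFun_sq_le d a).trans_eq ?_
    simp only [f, g, i, j, Function.comp_apply, Nat.cast_add, Nat.cast_one]
    ring_nf
  have hs := (hf.comp_injective hi).add (hg.comp_injective hj)
  have hsum := Summable.of_nonneg_of_le (fun a => sq_nonneg _) hle hs
  refine ⟨hsum, ?_⟩
  calc ∑' a, ‖coshiftFun d a‖ ^ 2 ≤ ∑' a, ((f ∘ i) a + (g ∘ j) a) := hsum.tsum_le_tsum hle hs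
    _ = tsum (f ∘ i) + tsum (g ∘ j) :=
      (hf.comp_injective hi).tsum_add (hg.comp_injective hj)
    _ ≤ tsum f + tsum g := add_le_add (tsum_comp_le_tsum_of_inj hf hf0 hi)
      (tsum_comp_le_tsum_of_inj hg hg0 hj)
    _ = ∑' b, (f b + g b) := (hf.tsum_add hg).symm
    _ ≤ ∑' b, ‖d b‖ ^ 2 := (hf.add hg).tsum_le_tsum hfg hd

theorem CoeffSpace.summable_norm_sq (d : CoeffSpace) : Summable fun a => ‖d a‖ ^ 2 := by
  simpa using (memℓp_gen_iff (by norm_num)).1 (lp.memℓp d)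

/-- The adjoint of multiplication by `diagCoord`. -/
noncomputable def coshift : CoeffSpace →L[ℂ] CoeffSpace :=
  LinearMap.mkContinuous
    { toFun := fun d => ⟨coshiftFun d, memℓp_gen (by
        simpa using (summable_coshiftFun_and_tsum_le d.summable_norm_sq).1)⟩
      map_add' := fun d e => by
        ext a
        simp only [coshiftFun, lp.coeFn_add, Pi.add_apply]
        ring
      map_smul' := fun c d => by
        ext a
        simp only [coshiftFun, lp.coeFn_smul, Pi.smul_apply, smul_eq_mul, RingHom.id_apply]
        ring } 1 (fun d => by
      rw [one_mul]
      refine lp.norm_le_of_tsum_le (by norm_num) (norm_nonneg _) ?_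
      rw [lp.norm_rpow_eq_tsum (by norm_num)]
      simpa using (summable_coshiftFun_and_tsum_le d.summable_norm_sq).2)

theorem norm_coshift_le_one : ‖coshift‖ ≤ 1 := LinearMap.mkContinuous_norm_le _ zero_le_one _

theorem norm_coshift_pow_le_one (k : ℕ) : ‖coshift ^ k‖ ≤ 1 := by
  induction k with
  | zero => exact ContinuousLinearMap.norm_id_le
  | succ k ih =>
    rw [pow_succ]
    exact (norm_mul_le _ _).trans (mul_le_one₀ ih (norm_nonneg _) norm_coshift_le_one)

theorem coshift_apply (d : CoeffSpace) (a : ℕ × ℕ) : coshift d a = coshiftFun d a := rfl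

/-- The square roots in `coshiftFun` are the ratios of norms of neighbouring monomials, so they
cancel by the recursions for binomial coefficients. -/
theorem coshift_kernelVec (z : UnitBall 2) :
    coshift (kernelVec z) = conj (diagCoord z) • kernelVec z := by
  have key : ∀ m n N k : ℕ, N * k = m * n → 0 < n →
      Real.sqrt (k / n) * Real.sqrt N = Real.sqrt m := fun m n N k h hn => by
    rw [← Real.sqrt_mul (by positivity)]
    congr 1
    have h2 : (N : ℝ) * k = m * n := by exact_mod_cast h
    field_simp
    linarith
  ext a
  have h0 := key ((a.1 + a.2).choose a.1) (a.1 + a.2 + 1) ((a.1 + 1 + a.2).choose (a.1 + 1))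
    (a.1 + 1) (by
      rw [add_right_comm, ← Nat.add_one_mul_choose_eq, mul_comm]) (Nat.succ_pos _)
  have h1 := key ((a.1 + a.2).choose a.1) (a.1 + a.2 + 1) ((a.1 + (a.2 + 1)).choose a.1)
    (a.2 + 1) (by
      rw [Nat.choose_mul_succ_eq, ← add_assoc]
      congr 1
      omega) (Nat.succ_pos _)
  push_cast at h0 h1
  simp only [coshift_apply, coshiftFun, kernelVec_apply, lp.coeFn_smul, Pi.smul_apply,
    smul_eq_mul, diagCoord, map_mul, map_add, map_inv₀, conj_ofReal]
  rw [← mul_assoc (Real.sqrt _ : ℂ) (Real.sqrt _ : ℂ), ← ofReal_mul, h0,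
    ← mul_assoc (Real.sqrt ((a.2 + 1) / _) : ℂ) (Real.sqrt _ : ℂ), ← ofReal_mul, h1]
  ring

/-- Absolutely convergent power series in `diagCoord` are multipliers. -/
theorem tsum_diagCoord_mem_multiplierAlgebra {μ : ℕ → ℂ} (hμ : Summable fun k => ‖μ k‖) :
    (fun z => ∑' k, μ k * diagCoord z ^ k) ∈ multiplierAlgebra (druryArveson 2) := by
  -- This series converges in operator norm and has every kernel vector as an eigenvector, so its
  -- adjoint is multiplication by the conjugate eigenvalue.
  have hA : Summable fun k => conj (μ k) • coshift ^ k := by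
    refine Summable.of_norm_bounded hμ fun k => ?_
    rw [norm_smul, RCLike.norm_conj]
    exact mul_le_of_le_one_right (norm_nonneg _) (norm_coshift_pow_le_one k)
  have hpow : ∀ z k, (coshift ^ k) (kernelVec z) = conj (diagCoord z ^ k) • kernelVec z := by
    intro z k
    induction k with
    | zero => simp
    | succ k ih =>
      rw [pow_succ', mul_apply_eq_comp, ih, map_smul, coshift_kernelVec, smul_smul,
        pow_succ, map_mul]
  have hAk : ∀ z, (∑' k, conj (μ k) • coshift ^ k) (kernelVec z) =
      conj (∑' k, μ k * diagCoord z ^ k) • kernelVec z := by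
    intro z
    have h1 := hA.hasSum.mapL (ContinuousLinearMap.apply ℂ CoeffSpace (kernelVec z))
    have h2 : Summable fun k => μ k * diagCoord z ^ k := by
      refine Summable.of_norm_bounded hμ fun k => ?_
      rw [norm_mul, norm_pow]
      exact mul_le_of_le_one_right (norm_nonneg _)
        (pow_le_one₀ (norm_nonneg _) (norm_diagCoord_lt_one z).le)
    have h3 := (h2.hasSum.map (starRingEnd ℂ) continuous_conj).smul_const (kernelVec z)
    refine h1.unique ((congrArg (HasSum · _) (funext fun k => ?_)).mpr h3)
    simp [hpow, smul_smul]
  intro h hh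
  obtain ⟨d, hd⟩ := (mem_druryArveson_two_iff h).1 hh
  refine (mem_druryArveson_two_iff _).2
    ⟨ContinuousLinearMap.adjoint (∑' k, conj (μ k) • coshift ^ k) d, fun z => ?_⟩
  rw [ContinuousLinearMap.adjoint_inner_right, hAk, inner_smul_left, conj_conj, ← hd]
  rfl

/-! ### Uniform boundedness and the Lipschitz estimate for multipliers -/

/-- A weighted form of the principle of uniform boundedness. -/
theorem exists_forall_norm_apply_le_of_pointwise {E ι : Type*} [NormedAddCommGroup E]
    [NormedSpace ℂ E] [CompleteSpace E] (L : ι → E →L[ℂ] ℂ) (e : ι → ℝ) (he : ∀ i, 0 ≤ e i)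
    (h : ∀ x, ∃ C, ∀ i, ‖L i x‖ ≤ C * e i) : ∃ C, ∀ i x, ‖L i x‖ ≤ C * e i * ‖x‖ := by
  -- Where `e i = 0` the rescaled functional is zero; there the pointwise bound itself says `L i =
  -- 0`.
  obtain ⟨C, hC⟩ := banach_steinhaus (g := fun i => ((e i)⁻¹ : ℂ) • L i) (fun x => by
    obtain ⟨C, hC⟩ := h x
    refine ⟨|C|, fun i => ?_⟩
    have h1 := (hC i).trans (mul_le_mul_of_nonneg_right (le_abs_self C) (he i))
    rw [smul_apply, norm_smul, norm_inv, norm_real,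
      Real.norm_of_nonneg (he i)]
    rcases (he i).eq_or_lt with h0 | h0
    · simp [← h0]
    · rwa [inv_mul_le_iff₀ h0, mul_comm])
  refine ⟨C, fun i x => ?_⟩
  rcases (he i).eq_or_lt with h0 | h0
  · obtain ⟨C', hC'⟩ := h x
    have := hC' i
    rw [← h0, mul_zero] at this
    rwa [← h0, mul_zero, zero_mul]
  · have h1 := (((e i)⁻¹ : ℂ) • L i).le_of_opNorm_le (hC i) x
    rw [smul_apply, norm_smul, norm_inv, norm_real,
      Real.norm_of_nonneg (he i), inv_mul_le_iff₀ h0] at h1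
    linarith

theorem norm_kernelVec_pos (z : UnitBall 2) : 0 < ‖kernelVec z‖ := by
  refine norm_pos_iff.2 fun h => ?_
  have h1 : kernelVec z (0, 0) = 0 := by rw [h]; rfl
  simp [kernelVec_apply] at h1

/-- A multiplier is Lipschitz with respect to the distance of normalized kernel vectors. -/
theorem exists_norm_sub_le_of_mem_multiplierAlgebra {Φ : UnitBall 2 → ℂ}
    (hΦ : Φ ∈ multiplierAlgebra (druryArveson 2)) :
    ∃ C, ∀ p q, ‖kernelVec p‖ = ‖kernelVec q‖ →
      ‖Φ p - Φ q‖ ≤ C * (‖kernelVec p - kernelVec q‖ / ‖kernelVec p‖) := by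
  -- If `e` represents `Φ h`, these functionals at `h` are pairings of `e` with `k_p - c̄ k_q`,
  -- which gives the pointwise bound. The value `c = 0` will bound `Φ`, and `c = 1` will compare two
  -- points.
  obtain ⟨C, hC⟩ := exists_forall_norm_apply_le_of_pointwise
    (fun i : UnitBall 2 × UnitBall 2 × ℂ => Φ i.1 • innerSL ℂ (kernelVec i.1) -
      (i.2.2 * Φ i.2.1) • innerSL ℂ (kernelVec i.2.1))
    (fun i => ‖kernelVec i.1 - conj i.2.2 • kernelVec i.2.1‖) (fun i => norm_nonneg _)
    (fun d => by
      obtain ⟨e, he⟩ := (mem_druryArveson_two_iff _).1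
        (hΦ _ ((mem_druryArveson_two_iff _).2 ⟨d, fun z => rfl⟩))
      refine ⟨‖e‖, fun i => ?_⟩
      have h1 : (Φ i.1 • innerSL ℂ (kernelVec i.1) -
          (i.2.2 * Φ i.2.1) • innerSL ℂ (kernelVec i.2.1)) d =
          inner ℂ (kernelVec i.1 - conj i.2.2 • kernelVec i.2.1) e := by
        rw [inner_sub_left, inner_smul_left, conj_conj, ← he, ← he]
        simp [mul_assoc]
      rw [h1, mul_comm]
      exact norm_inner_le_norm _ _)
  refine ⟨2 * C, fun p q hpq => ?_⟩
  have hN := norm_kernelVec_pos p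
  set N := ‖kernelVec p‖ with hNdef
  have hself : ∀ z, inner ℂ (kernelVec z) (kernelVec z) = ((‖kernelVec z‖ : ℂ)) ^ 2 := fun z =>
    inner_self_eq_norm_sq_to_K _
  have hq : ‖Φ q‖ ≤ C := by
    have h := hC (q, p, 0) (kernelVec q)
    simp only [sub_apply, zero_mul, zero_smul, sub_zero, map_zero, smul_apply,
      innerSL_apply_apply, hself, smul_eq_mul, norm_mul, norm_pow, norm_real,
      ← hpq] at h
    rw [mul_assoc, ← sq, Real.norm_of_nonneg hN.le] at h
    exact le_of_mul_le_mul_right h (pow_pos hN 2)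
  have h := hC (p, q, 1) (kernelVec p)
  simp only [one_mul, one_smul, map_one, smul_apply,
    sub_apply, innerSL_apply_apply, hself, smul_eq_mul, ← hNdef] at h
  have hd : (Φ p - Φ q) * (N : ℂ) ^ 2 =
      (Φ p * (N : ℂ) ^ 2 - Φ q * inner ℂ (kernelVec q) (kernelVec p)) -
        Φ q * inner ℂ (kernelVec q) (kernelVec q - kernelVec p) := by
    rw [inner_sub_right, hself, ← hpq]
    ring
  have hn := congrArg norm hd
  have h2 : ‖Φ q * inner ℂ (kernelVec q) (kernelVec q - kernelVec p)‖ ≤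
      C * (N * ‖kernelVec p - kernelVec q‖) := by
    rw [norm_mul, norm_sub_rev (kernelVec p), hpq]
    exact mul_le_mul hq (norm_inner_le_norm _ _) (norm_nonneg _) ((norm_nonneg _).trans hq)
  rw [norm_mul, norm_pow, norm_real, hNdef, norm_norm, ← hNdef] at hn
  have h3 := hn.le.trans ((norm_sub_le _ _).trans (add_le_add h h2))
  rw [mul_div_assoc', le_div_iff₀ hN]
  refine le_of_mul_le_mul_right ?_ hN
  linarith

/-! ### Test functions with summable coefficients -/

/-- Evaluation of power series with summable coefficients at a point of the disc. -/
noncomputable def powerSeriesEval (ζ : ℂ) (hζ : ‖ζ‖ < 1) :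
    lp (fun _ : ℕ => ℂ) 1 →L[ℂ] ℂ :=
  have hs : ∀ μ : lp (fun _ : ℕ => ℂ) 1, Summable fun k => μ k * ζ ^ k := fun μ => by
    refine Summable.of_norm_bounded (g := fun k => ‖μ k‖)
      (by simpa using (lp.memℓp μ).summable (by norm_num)) fun k => ?_
    rw [norm_mul, norm_pow]
    exact mul_le_of_le_one_right (norm_nonneg _) (pow_le_one₀ (norm_nonneg _) hζ.le)
  LinearMap.mkContinuous
    { toFun := fun μ => ∑' k, μ k * ζ ^ k
      map_add' := fun μ ν => by
        rw [← (hs μ).tsum_add (hs ν)]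
        simp [add_mul]
      map_smul' := fun c μ => by
        simp [mul_assoc, tsum_mul_left] } 1 (fun μ => by
      have h1 : Summable fun k => ‖μ k‖ := by
        simpa using (lp.memℓp μ).summable (by norm_num)
      have h2 : ‖μ‖ = ∑' k, ‖μ k‖ := by
        simpa using lp.norm_rpow_eq_tsum (p := 1) (by norm_num) μ
      rw [one_mul, h2]
      refine tsum_of_norm_bounded h1.hasSum fun k => ?_
      rw [norm_mul, norm_pow]
      exact mul_le_of_le_one_right (norm_nonneg _) (pow_le_one₀ (norm_nonneg _) hζ.le))

theorem powerSeriesEval_apply (ζ : ℂ) (hζ : ‖ζ‖ < 1) (μ : lp (fun _ : ℕ => ℂ) 1) :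
    powerSeriesEval ζ hζ μ = ∑' k, μ k * ζ ^ k := rfl

theorem mem_discMultiplierAlgebra_iff_exists {d : ℕ} (f : UnitDisc → UnitBall d)
    (m : UnitDisc → ℂ) :
    m ∈ discMultiplierAlgebra f ↔ ∃ Φ ∈ multiplierAlgebra (druryArveson d), Φ ∘ f = m := by
  constructor
  · rintro ⟨_, ⟨Φ, hΦ, rfl⟩, rfl⟩
    exact ⟨Φ, hΦ, rfl⟩
  · rintro ⟨Φ, hΦ, rfl⟩
    exact ⟨_, ⟨Φ, hΦ, rfl⟩, rfl⟩

/-- If the multiplier algebra of `g` is contained in that of `f`, then the resolvents of `diagCoord`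
along `g` are controlled by the distance of normalized kernel vectors along `f`. -/
theorem exists_norm_resolvent_sub_le {f g : UnitDisc → UnitBall 2}
    (hfg : discMultiplierAlgebra g ≤ discMultiplierAlgebra f) :
    ∃ C, ∀ z w, ‖kernelVec (f z)‖ = ‖kernelVec (f w)‖ → ∀ ε ∈ Set.Ioo (0 : ℝ) 1,
      ‖(ε : ℂ) / (1 - (1 - ε) * diagCoord (g z)) - ε / (1 - (1 - ε) * diagCoord (g w))‖ ≤
        C * (‖kernelVec (f z) - kernelVec (f w)‖ / ‖kernelVec (f z)‖) := by
  -- Each power series has its own Lipschitz constant along `f`; uniform boundedness on `ℓ¹` turns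
  -- these into one constant times `‖μ‖`.
  obtain ⟨C, hC⟩ := exists_forall_norm_apply_le_of_pointwise
    (fun i : {i : UnitDisc × UnitDisc // ‖kernelVec (f i.1)‖ = ‖kernelVec (f i.2)‖} =>
      powerSeriesEval _ (norm_diagCoord_lt_one (g i.1.1)) -
        powerSeriesEval _ (norm_diagCoord_lt_one (g i.1.2)))
    (fun i => ‖kernelVec (f i.1.1) - kernelVec (f i.1.2)‖ / ‖kernelVec (f i.1.1)‖)
    (fun i => by positivity) (fun μ => by
      have h1 : Summable fun k => ‖μ k‖ := by
        simpa using (lp.memℓp μ).summable (by norm_num)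
      obtain ⟨Φ, hΦ, h2⟩ := (mem_discMultiplierAlgebra_iff_exists f _).1
        (hfg ((mem_discMultiplierAlgebra_iff_exists g _).2
          ⟨_, tsum_diagCoord_mem_multiplierAlgebra h1, rfl⟩))
      obtain ⟨C, hC⟩ := exists_norm_sub_le_of_mem_multiplierAlgebra hΦ
      refine ⟨C, fun i => ?_⟩
      have h3 := hC (f i.1.1) (f i.1.2) i.2
      have h4 := congrFun h2 i.1.1
      have h5 := congrFun h2 i.1.2
      simp only [Function.comp_apply] at h4 h5
      rw [h4, h5] at h3
      exact h3)
  refine ⟨C, fun z w hzw ε hε => ?_⟩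
  have hρ : ‖((1 - ε : ℝ) : ℂ)‖ < 1 := by
    rw [norm_real, Real.norm_of_nonneg (by linarith [hε.2])]
    linarith [hε.1]
  -- The coefficients `ε (1 - ε)^k` are nonnegative with sum one, so the bound does not depend on
  -- `ε`.
  have hgeo : HasSum (fun k => ‖(ε : ℂ) * ((1 - ε : ℝ) : ℂ) ^ k‖) 1 := by
    have h := (hasSum_geometric_of_lt_one (norm_nonneg _) hρ).mul_left ε
    rw [norm_real, Real.norm_of_nonneg (by linarith [hε.2])] at h
    rw [sub_sub_cancel, mul_inv_cancel₀ hε.1.ne'] at h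
    refine (congrArg (HasSum · _) (funext fun k => ?_)).mpr h
    rw [norm_mul, norm_pow, norm_real, norm_real, Real.norm_of_nonneg hε.1.le,
      Real.norm_of_nonneg (by linarith [hε.2])]
  let μ : lp (fun _ : ℕ => ℂ) 1 := ⟨fun k => (ε : ℂ) * ((1 - ε : ℝ) : ℂ) ^ k,
    memℓp_gen (by simpa using hgeo.summable)⟩
  have hμ : ‖μ‖ = 1 := by
    have h := lp.norm_rpow_eq_tsum (p := 1) (by norm_num) μ
    simp only [ENNReal.toReal_one, Real.rpow_one] at h
    exact h.trans hgeo.tsum_eq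
  have hev : ∀ p : UnitBall 2, powerSeriesEval _ (norm_diagCoord_lt_one p) μ =
      (ε : ℂ) / (1 - (1 - ε) * diagCoord p) := by
    intro p
    have h1 : ‖((1 - ε : ℝ) : ℂ) * diagCoord p‖ < 1 := by
      rw [norm_mul]
      exact mul_lt_one_of_nonneg_of_lt_one_left (norm_nonneg _) hρ (norm_diagCoord_lt_one p).le
    have h2 := (hasSum_geometric_of_norm_lt_one h1).mul_left (ε : ℂ)
    rw [powerSeriesEval_apply, div_eq_mul_inv]
    push_cast at h2
    rw [← h2.tsum_eq]
    refine tsum_congr fun k => ?_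
    simp only [μ]
    push_cast
    rw [mul_pow, mul_assoc]
  have h := hC ⟨(z, w), hzw⟩ μ
  rwa [hμ, mul_one, sub_apply, hev, hev] at h

/-! ### Pairs of points swapped by the embedding -/

theorem mobius_ofReal (r t : ℝ) : mobius r (t : ℂ) = (((t - r) / (1 - r * t) : ℝ) : ℂ) := by
  simp [mobius]

theorem coord_zero_discEmbedding (r : ℝ) (hr : r ∈ Set.Ioo (0 : ℝ) 1) (z : UnitDisc) :
    (discEmbedding r hr z).coord 0 = (Real.sqrt 2 : ℂ)⁻¹ * (z : ℂ) ^ 2 := by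
  simp [discEmbedding, UnitBall.coord]

theorem coord_one_discEmbedding (r : ℝ) (hr : r ∈ Set.Ioo (0 : ℝ) 1) (z : UnitDisc) :
    (discEmbedding r hr z).coord 1 = (Real.sqrt 2 : ℂ)⁻¹ * mobius r z ^ 2 := by
  simp [discEmbedding, UnitBall.coord]

theorem inv_sqrt_two_mul_self : (Real.sqrt 2 : ℂ)⁻¹ * (Real.sqrt 2 : ℂ)⁻¹ = 2⁻¹ := by
  rw [← mul_inv, ← ofReal_mul, Real.mul_self_sqrt zero_le_two, ofReal_ofNat]

theorem diagCoord_discEmbedding (r : ℝ) (hr : r ∈ Set.Ioo (0 : ℝ) 1) (z : UnitDisc) :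
    diagCoord (discEmbedding r hr z) = ((z : ℂ) ^ 2 + mobius r z ^ 2) / 2 := by
  rw [diagCoord, coord_zero_discEmbedding, coord_one_discEmbedding]
  linear_combination ((z : ℂ) ^ 2 + mobius r z ^ 2) * inv_sqrt_two_mul_self

/-- Normalized kernel vectors at two real points that are exchanged by the swap of coordinates. -/
theorem norm_kernelVec_sub_of_swap {p q : UnitBall 2} {x y : ℝ} (hx : x ∈ Set.Ico (0 : ℝ) 1)
    (hy : y ∈ Set.Ico (0 : ℝ) 1)
    (hp0 : p.coord 0 = (Real.sqrt 2 : ℂ)⁻¹ * x) (hp1 : p.coord 1 = (Real.sqrt 2 : ℂ)⁻¹ * y)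
    (hq0 : q.coord 0 = (Real.sqrt 2 : ℂ)⁻¹ * y) (hq1 : q.coord 1 = (Real.sqrt 2 : ℂ)⁻¹ * x) :
    ‖kernelVec p‖ = ‖kernelVec q‖ ∧
      ‖kernelVec p - kernelVec q‖ / ‖kernelVec p‖ ≤ Real.sqrt |x - y| := by
  obtain ⟨hx0, hx1⟩ := hx
  obtain ⟨hy0, hy1⟩ := hy
  have hself : ∀ z, ((‖kernelVec z‖ ^ 2 : ℝ) : ℂ) = inner ℂ (kernelVec z) (kernelVec z) :=
    fun z => by
      rw [ofReal_pow]
      exact (inner_self_eq_norm_sq_to_K (𝕜 := ℂ) (kernelVec z)).symm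
  have hp : ‖kernelVec p‖ ^ 2 = (1 - (x ^ 2 + y ^ 2) / 2)⁻¹ := by
    rw [← ofReal_inj, hself, inner_kernelVec, hp0, hp1]
    push_cast
    simp only [map_mul, map_inv₀, conj_ofReal]
    congr 1
    linear_combination (-(x : ℂ) ^ 2 - (y : ℂ) ^ 2) * inv_sqrt_two_mul_self
  have hq : ‖kernelVec q‖ ^ 2 = (1 - (x ^ 2 + y ^ 2) / 2)⁻¹ := by
    rw [← ofReal_inj, hself, inner_kernelVec, hq0, hq1]
    push_cast
    simp only [map_mul, map_inv₀, conj_ofReal]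
    congr 1
    linear_combination (-(x : ℂ) ^ 2 - (y : ℂ) ^ 2) * inv_sqrt_two_mul_self
  have hpq : inner ℂ (kernelVec p) (kernelVec q) = (((1 - x * y)⁻¹ : ℝ) : ℂ) := by
    rw [inner_kernelVec, hp0, hp1, hq0, hq1]
    push_cast
    simp only [map_mul, map_inv₀, conj_ofReal]
    congr 1
    linear_combination (-2 * (x : ℂ) * (y : ℂ)) * inv_sqrt_two_mul_self
  have heq : ‖kernelVec p‖ = ‖kernelVec q‖ :=
    (sq_eq_sq₀ (norm_nonneg _) (norm_nonneg _)).1 (hp.trans hq.symm)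
  refine ⟨heq, Real.le_sqrt_of_sq_le ?_⟩
  have hs := norm_sub_sq (𝕜 := ℂ) (kernelVec p) (kernelVec q)
  rw [hpq, hp, hq] at hs
  have hre : RCLike.re ((((1 - x * y)⁻¹ : ℝ) : ℂ)) = (1 - x * y)⁻¹ := ofReal_re _
  rw [hre] at hs
  have h1 : 0 < 1 - x * y := by nlinarith
  have h2 : 0 < 1 - (x ^ 2 + y ^ 2) / 2 := by nlinarith
  have h3 : |x - y| ≤ 1 - x * y := by
    rw [abs_le]
    constructor <;> nlinarith
  -- With `A = 1 - (x² + y²) / 2` and `P = 1 - xy` one has `(x - y)² = 2(P - A)`, so the squared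
  -- distance `2 / A - 2 / P` equals `(x - y)² / (A P)`.
  have h4 : (1 - (x ^ 2 + y ^ 2) / 2)⁻¹ - 2 * (1 - x * y)⁻¹ + (1 - (x ^ 2 + y ^ 2) / 2)⁻¹ =
      (1 - (x ^ 2 + y ^ 2) / 2)⁻¹ * (|x - y| * |x - y| / (1 - x * y)) := by
    rw [abs_mul_abs_self]
    have h5 : (x - y) * (x - y) = 2 * (1 - x * y) - 2 * (1 - (x ^ 2 + y ^ 2) / 2) := by ring
    rw [h5]
    generalize 1 - (x ^ 2 + y ^ 2) / 2 = A at h2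
    generalize 1 - x * y = P at h1
    field_simp
    ring
  rw [div_pow, hs, hp, h4, mul_div_cancel_left₀ _ (inv_ne_zero h2.ne'), div_le_iff₀ h1]
  exact mul_le_mul_of_nonneg_left h3 (abs_nonneg _)

/-- Holds because `b_r(-u) = -b_{-r}(u)` and `b_{-r}` inverts `b_r`. Hence `z ↦ -b_r(z)` swaps the
coordinates of `f_r`. -/
theorem mobius_neg_mobius {r : ℝ} (hr : r ∈ Set.Ioo (0 : ℝ) 1) (z : UnitDisc) :
    mobius r (-mobius r z) = -z := by
  have h := mobius_denom_ne_zero hr z.norm_lt_one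
  have h1 : (1 : ℂ) - (r : ℂ) ^ 2 ≠ 0 := by
    have : (1 : ℝ) - r ^ 2 ≠ 0 := by nlinarith [hr.1, hr.2]
    exact_mod_cast this
  obtain ⟨D, hD⟩ : ∃ D, D = 1 - (r : ℂ) * z := ⟨_, rfl⟩
  rw [← hD] at h
  have h2 : 1 - (r : ℂ) * -mobius r z = (1 - (r : ℂ) ^ 2) / D := by
    rw [mobius, ← hD]
    field_simp
    rw [hD]
    ring
  rw [mobius, h2, mobius, ← hD]
  field_simp
  rw [hD]
  ring

/-! ### Rates of approach to the peak point -/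

/-- The defect `1 - (t² + b_s(t)²) / 2` at `t = 1 - ε`, divided by `ε`. -/
noncomputable def defectQuotientRight (s ε : ℝ) : ℝ :=
  (2 - ε + (1 + s) / (1 - s * (1 - ε)) * (1 + (1 - ε - s) / (1 - s * (1 - ε)))) / 2

/-- Split `1 - x² = (1 - x)(1 + x)` and use `1 - b_s(t) = (1 + s)(1 - t) / (1 - st)`. With `ε`
divided out, the limit at `0` is found by evaluation. -/
theorem one_sub_eq_mul_defectQuotientRight {s ε : ℝ} (h : 1 - s * (1 - ε) ≠ 0) :
    1 - ((1 - ε) ^ 2 + ((1 - ε - s) / (1 - s * (1 - ε))) ^ 2) / 2 =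
      ε * defectQuotientRight s ε := by
  unfold defectQuotientRight
  obtain ⟨D, hD⟩ : ∃ D, D = 1 - s * (1 - ε) := ⟨_, rfl⟩
  rw [← hD] at h ⊢
  field_simp
  rw [hD]
  ring

/-- The defect `1 - (t² + b_s(t)²) / 2` at `t = -b_r(1 - ε)`, divided by `ε`. -/
noncomputable def defectQuotientLeft (r s ε : ℝ) : ℝ :=
  (1 + r) / (1 - r * (1 - ε)) * (1 + (1 - ε - r) / (1 - r * (1 - ε)) +
    (1 - s) / (1 + s * ((1 - ε - r) / (1 - r * (1 - ε)))) *
      (1 + ((1 - ε - r) / (1 - r * (1 - ε)) + s) /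
        (1 + s * ((1 - ε - r) / (1 - r * (1 - ε)))))) / 2

/-- With `y = b_r(1 - ε)`, `b_s(-y) = -(y + s) / (1 + sy)` and `1 - (y + s) / (1 + sy) = (1 - s)(1 -
y) / (1 + sy)`; the factor `ε` comes from `1 - y`. -/
theorem one_sub_eq_mul_defectQuotientLeft {r s ε : ℝ} (h : 1 - r * (1 - ε) ≠ 0)
    (h2 : 1 + s * ((1 - ε - r) / (1 - r * (1 - ε))) ≠ 0) :
    1 - (((1 - ε - r) / (1 - r * (1 - ε))) ^ 2 +
      ((-((1 - ε - r) / (1 - r * (1 - ε))) - s) /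
        (1 - s * -((1 - ε - r) / (1 - r * (1 - ε))))) ^ 2) / 2 =
      ε * defectQuotientLeft r s ε := by
  unfold defectQuotientLeft
  have hy : 1 - (1 - ε - r) / (1 - r * (1 - ε)) = ε * ((1 + r) / (1 - r * (1 - ε))) := by
    obtain ⟨D, hD⟩ : ∃ D, D = 1 - r * (1 - ε) := ⟨_, rfl⟩
    rw [← hD] at h ⊢
    field_simp
    rw [hD]
    ring
  generalize (1 + r) / (1 - r * (1 - ε)) = k at *
  generalize (1 - ε - r) / (1 - r * (1 - ε)) = y at *
  rw [mul_neg, sub_neg_eq_add]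
  have h3 : ε * (k * (1 + y + (1 - s) / (1 + s * y) * (1 + (y + s) / (1 + s * y))) / 2) =
      (1 - y) * (1 + y + (1 - s) / (1 + s * y) * (1 + (y + s) / (1 + s * y))) / 2 := by
    rw [hy]
    ring
  rw [h3]
  obtain ⟨D, hD⟩ : ∃ D, D = 1 + s * y := ⟨_, rfl⟩
  rw [← hD] at h2 ⊢
  field_simp
  rw [hD]
  ring

theorem div_one_sub_mul_eq {ε u G : ℝ} (hε : ε ≠ 0) (h : 1 - u = ε * G) :
    ε / (1 - (1 - ε) * u) = 1 / (1 + (1 - ε) * G) := by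
  have h1 : 1 - (1 - ε) * u = ε * (1 + (1 - ε) * G) := by linear_combination (1 - ε) * h
  rw [h1, div_mul_eq_div_div, div_self hε]

/-! ### Comparison of the two rates -/

/-- The resolvent estimate at `z = 1 - ε` and `w = -b_r(1 - ε)`, with the same `ε` as resolvent
parameter so that it cancels from both values. -/
theorem exists_abs_sub_le_of_le {r s : ℝ} (hr : r ∈ Set.Ioo (0 : ℝ) 1)
    (hs : s ∈ Set.Ioo (0 : ℝ) 1)
    (h : discMultiplierAlgebra (discEmbedding s hs) ≤
      discMultiplierAlgebra (discEmbedding r hr)) :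
    ∃ C, ∀ ε ∈ Set.Ioo (0 : ℝ) 1,
      |1 / (1 + (1 - ε) * defectQuotientRight s ε) -
        1 / (1 + (1 - ε) * defectQuotientLeft r s ε)| ≤
      C * Real.sqrt |(1 - ε) ^ 2 - ((1 - ε - r) / (1 - r * (1 - ε))) ^ 2| := by
  obtain ⟨C, hC⟩ := exists_norm_resolvent_sub_le h
  refine ⟨|C|, fun ε hε => ?_⟩
  have hnorm : ‖((1 - ε : ℝ) : ℂ)‖ < 1 := by
    rw [norm_real, Real.norm_of_nonneg (by linarith [hε.2])]
    linarith [hε.1]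
  obtain ⟨z, hz⟩ : ∃ z : UnitDisc, (z : ℂ) = ((1 - ε : ℝ) : ℂ) :=
    ⟨UnitDisc.mk _ hnorm, rfl⟩
  set y : ℝ := (1 - ε - r) / (1 - r * (1 - ε)) with hy
  have hzy : mobius r z = (y : ℂ) := by rw [hz, mobius_ofReal]
  have hylt : |y| < 1 := by
    have := norm_mobius_lt_one hr z
    rwa [hzy, norm_real, Real.norm_eq_abs] at this
  obtain ⟨w, hw⟩ : ∃ w : UnitDisc, (w : ℂ) = ((-y : ℝ) : ℂ) :=
    ⟨UnitDisc.mk ((-y : ℝ) : ℂ) (by rwa [norm_real, norm_neg, Real.norm_eq_abs]), rfl⟩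
  have hwm : mobius r w = -((1 - ε : ℝ) : ℂ) := by
    have := mobius_neg_mobius hr z
    rwa [hzy, ← ofReal_neg, ← hw, hz] at this
  obtain ⟨h1, h2⟩ := norm_kernelVec_sub_of_swap (p := discEmbedding r hr z)
    (q := discEmbedding r hr w) (x := (1 - ε) ^ 2) (y := y ^ 2)
    ⟨sq_nonneg _, by nlinarith [hε.1, hε.2]⟩ ⟨sq_nonneg _, (sq_lt_one_iff_abs_lt_one y).2 hylt⟩
    (by rw [coord_zero_discEmbedding, hz]; push_cast; ring)
    (by rw [coord_one_discEmbedding, hzy]; push_cast; ring)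
    (by rw [coord_zero_discEmbedding, hw]; push_cast; ring)
    (by rw [coord_one_discEmbedding, hwm]; push_cast; ring)
  have h3 := hC z w h1 ε hε
  rw [diagCoord_discEmbedding, diagCoord_discEmbedding, hz, hw, mobius_ofReal,
    mobius_ofReal] at h3
  have hε0 := hε.1.ne'
  have hd : ∀ t ∈ Set.Ioo (0 : ℝ) 1, 1 - t * (1 - ε) ≠ 0 := fun t ht => by
    nlinarith [hε.1, hε.2, ht.1, ht.2]
  have hsy : 1 + s * y ≠ 0 := by
    have := abs_lt.1 hylt
    nlinarith [hs.1, hs.2]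
  rw [← div_one_sub_mul_eq hε0 (one_sub_eq_mul_defectQuotientRight (hd s hs)),
    ← div_one_sub_mul_eq hε0 (one_sub_eq_mul_defectQuotientLeft (hd r hr) hsy), ← hy]
  have h4 : ∀ x : ℝ, |x| = ‖(x : ℂ)‖ := fun x => (norm_real x).symm
  rw [h4]
  push_cast
  push_cast at h3
  rw [neg_sq] at h3
  refine h3.trans ?_
  exact (mul_le_mul_of_nonneg_right (le_abs_self C) (by positivity)).trans
    (mul_le_mul_of_nonneg_left h2 (abs_nonneg C))

theorem eq_of_discMultiplierAlgebra_le {r s : ℝ} (hr : r ∈ Set.Ioo (0 : ℝ) 1)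
    (hs : s ∈ Set.Ioo (0 : ℝ) 1)
    (h : discMultiplierAlgebra (discEmbedding s hs) ≤
      discMultiplierAlgebra (discEmbedding r hr)) : r = s := by
  obtain ⟨C, hC⟩ := exists_abs_sub_le_of_le hr hs h
  obtain ⟨hr0, hr1⟩ := hr
  obtain ⟨hs0, hs1⟩ := hs
  have hr2 : 1 - r ≠ 0 := by linarith
  have hs2 : 1 - s ≠ 0 := by linarith
  have hs3 : 1 + s ≠ 0 := by linarith
  have hR : defectQuotientRight s 0 = 2 / (1 - s) := by
    unfold defectQuotientRight
    simp only [sub_zero, mul_one]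
    field_simp
    ring
  have hL : defectQuotientLeft r s 0 = 2 * (1 + r) / ((1 - r) * (1 + s)) := by
    unfold defectQuotientLeft
    simp only [sub_zero, mul_one, div_self hr2]
    field_simp
    ring
  have hR0 : 0 < 1 + (1 - 0) * defectQuotientRight s 0 := by
    rw [hR]
    have := div_pos two_pos (sub_pos.2 hs1)
    linarith
  have hL0 : 0 < 1 + (1 - 0) * defectQuotientLeft r s 0 := by
    rw [hL]
    have : 0 < 2 * (1 + r) / ((1 - r) * (1 + s)) :=
      div_pos (by linarith) (mul_pos (by linarith) (by linarith))
    linarith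
  have hcR : ContinuousAt (defectQuotientRight s) 0 := by
    unfold defectQuotientRight
    have h1 : 1 - s * (1 - 0) ≠ 0 := by simpa using hs2
    fun_prop (disch := assumption)
  have hcL : ContinuousAt (defectQuotientLeft r s) 0 := by
    unfold defectQuotientLeft
    have h1 : 1 - r * (1 - 0) ≠ 0 := by simpa using hr2
    have h2 : 1 + s * ((1 - 0 - r) / (1 - r * (1 - 0))) ≠ 0 := by
      simpa [div_self hr2] using hs3
    fun_prop (disch := assumption)
  have hc1 : ContinuousAt (fun ε => |1 / (1 + (1 - ε) * defectQuotientRight s ε) -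
      1 / (1 + (1 - ε) * defectQuotientLeft r s ε)|) 0 := by
    have h1 := hR0.ne'
    have h2 := hL0.ne'
    fun_prop (disch := assumption)
  have hc2 : ContinuousAt (fun ε => C * Real.sqrt
      |(1 - ε) ^ 2 - ((1 - ε - r) / (1 - r * (1 - ε))) ^ 2|) 0 := by
    have h1 : 1 - r * (1 - 0) ≠ 0 := by simpa using hr2
    fun_prop (disch := assumption)
  have hle := le_of_tendsto_of_tendsto (hc1.tendsto.mono_left nhdsWithin_le_nhds)
    (hc2.tendsto.mono_left nhdsWithin_le_nhds)
    (Filter.eventually_of_mem (Ioo_mem_nhdsGT one_pos) hC)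
  have hz : |(1 - 0 : ℝ) ^ 2 - ((1 - 0 - r) / (1 - r * (1 - 0))) ^ 2| = 0 := by
    simp [div_self hr2]
  rw [hz, Real.sqrt_zero, mul_zero] at hle
  have h0 := sub_eq_zero.1 (abs_nonpos_iff.1 hle)
  -- Equality of the limits reads `2 / (1 - s) = 2(1 + r) / ((1 - r)(1 + s))`, that is `(1 - r)(1 +
  -- s) = (1 + r)(1 - s)`.
  rw [div_eq_div_iff hR0.ne' hL0.ne', hR, hL] at h0
  field_simp at h0
  linarith

theorem mainTheorem6 (r s : ℝ) (hr : r ∈ Set.Ioo (0 : ℝ) 1) (hs : s ∈ Set.Ioo (0 : ℝ) 1)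
    (hrs : r ≠ s) :
    discMultiplierAlgebra (discEmbedding r hr) ≠ discMultiplierAlgebra (discEmbedding s hs) := by
  exact fun h => hrs (eq_of_discMultiplierAlgebra_le hr hs h.ge)
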